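/- Let $\mathsf X,\mathsf Y,\mathsf W,\mathsf A$ be standard Borel spaces; all functions below are assumed measurable. Let $P_W$ be a prior on $\mathsf W$ and $w\mapsto P_{Z|W=w}$ a probability kernel from $\mathsf W$ to $\mathsf X\times\mathsf Y$. Let $n\ge 0$, and let the parameter $W$, the data $Z^n=(Z_1,\dots,Z_n)$ and the fresh pair $Z=(X,Y)$ have joint law $P_{W,Z^n,Z}=P_W\big(\prod_{i=1}^nP_{Z_i|W}\big)P_{Z|W}$ with $P_{Z_i|W}=P_{Z|W}$. For a loss $\ell:\mathsf Y\times\mathsf A\to\mathbb R$ and an observation $V$ let $R_\ell(Y|V)=\inf_\psi\mathbb E[\ell(Y,\psi(V))]$, the infimum being over all $\mathsf A$-valued decision rules $\psi$ for which the expectation is defined (possibly infinite). Let $\mathrm{MER}_\ell=R_\ell(Y|X,Z^n)-R_\ell(Y|X,W)$ be the minimum excess risk. Let $\Psi^*:\mathsf X\times\mathsf W\to\mathsf A$ be an optimal omniscient decision rule: $\ell(Y,\Psi^*(X,W))$ is integrable and $\mathbb E[\ell(Y,\Psi^*(X,W))]=R_\ell(Y|X,W)$. Given $(X,Z^n)$,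 let $W'$ be sampled from the posterior $P_{W|X,Z^n}$, conditionally independently of everything else, and let $\mathbb E_{x,z^n}$ denote expectation under the conditional law $P_{Y|x,z^n}\otimes P_{W|x,z^n}$ of $(Y,W')$ given $(X,Z^n)=(x,z^n)$. Let $$I=I(\Psi^*(X,W);Y|X,Z^n)=\mathbb E\big[D_{\mathrm{KL}}\big(P_{\Psi^*(X,W),Y|X,Z^n}\,\big\|\,P_{\Psi^*(X,W)|X,Z^n}\otimes P_{Y|X,Z^n}\big)\big]\in[0,\infty].$$ For $b\in(0,\infty]$ and $\varphi:[0,b)\to\mathbb R$ put $\varphi^*(\gamma)=\sup_{0\le\lambda<b}\{\lambda\gamma-\varphi(\lambda)\}$ for $\gamma\in\mathbb R$, and $\varphi^{*-1}(u)=\sup\{\gamma\in\mathbb R:\varphi^*(\gamma)\le u\}$ for $u\in\mathbb R\cup\{+\infty\}$ (values in $[-\infty,\infty]$; in particular $\varphi^{*-1}(+\infty)=+\infty$). **Theorem.** 1. Suppose that for almost every $(x,z^n)$ under the law of $(X,Z^n)$ the variable $\ell(Y,\Psi^*(x,W'))$ has a finite conditional mean and, for all $0\le\lambda<b$, $$\log\mathbb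 E_{x,z^n}\Big[\exp\Big\{-\lambda\Big(\ell(Y,\Psi^*(x,W'))-\mathbb E_{x,z^n}[\ell(Y,\Psi^*(x,W'))]\Big)\Big\}\Big]\le\varphi(\lambda).$$ Then $\mathrm{MER}_\ell\le\varphi^{*-1}(I)$. 2. If $\varphi$ is strictly convex on $(0,b)$ and $\varphi(0)=\varphi'(0)=0$ (right derivative at $0$), then $\lim_{x\downarrow0}\varphi^{*-1}(x)=0$. 3. In particular, let $\sigma>0$, and suppose that for almost every $(x,z^n)$ the variable $L=\ell(Y,\Psi^*(x,W'))$ has a finite conditional mean and is $\sigma^2$-subgaussian conditionally on $(X,Z^n)=(x,z^n)$, that is, $\mathbb E_{x,z^n}[e^{\lambda(L-\mathbb E_{x,z^n}L)}]\le e^{\lambda^2\sigma^2/2}$ for all $\lambda\in\mathbb R$. Then $\mathrm{MER}_\ell\le\sqrt{2\sigma^2I}$. -/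

import Mathlib

open MeasureTheory ProbabilityTheory Filter Topology
open scoped ENNReal NNReal

namespace BayesLearning

/-! ### The generative model -/

section Model

variable {𝓧 𝓨 𝓦 : Type*} [MeasurableSpace 𝓧] [MeasurableSpace 𝓨] [MeasurableSpace 𝓦]

/-- The law of `n` i.i.d. draws from `P w` depends measurably on `w`. -/
theorem measurable_pi_kernel (P : Kernel 𝓦 (𝓧 × 𝓨)) [IsMarkovKernel P] (n : ℕ) :
    Measurable (fun w => Measure.pi (fun _ : Fin n => P w)) := by
  refine Measurable.measure_of_isPiSystem_of_isProbabilityMeasure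
    generateFrom_pi.symm isPiSystem_pi ?_
  rintro _ ⟨s, hs, rfl⟩
  simp only [Measure.pi_pi]
  exact Finset.measurable_prod _ fun i _ => P.measurable_coe (hs i (Set.mem_univ i))

/-- The kernel `w ↦ P_{Z|W=w}^{⊗ n}` generating the data set. -/
noncomputable def dataKernel (P : Kernel 𝓦 (𝓧 × 𝓨)) [IsMarkovKernel P] (n : ℕ) :
    Kernel 𝓦 (Fin n → 𝓧 × 𝓨) where
  toFun w := Measure.pi (fun _ : Fin n => P w)
  measurable' := measurable_pi_kernel P n

/-- The joint law `P_W (∏ᵢ P_{Zᵢ|W}) P_{Z|W}` of the parameters, the data set and the fresh pair,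
for the prior `π` and the parametrized family `P`. -/
noncomputable def jointLaw (π : Measure 𝓦) (P : Kernel 𝓦 (𝓧 × 𝓨)) [IsMarkovKernel P] (n : ℕ) :
    Measure (𝓦 × (Fin n → 𝓧 × 𝓨) × (𝓧 × 𝓨)) :=
  π ⊗ₘ (dataKernel P n ×ₖ P)

end Model

/-! ### Risks -/

section Risk

variable {Ω : Type*} [MeasurableSpace Ω]

/-- The expectation of `f` is defined as an extended real number: the positive and the negative
part do not both have an infinite integral. -/
def ExpectationDefined (f : Ω → ℝ) (μ : Measure Ω) : Prop :=
  ∫⁻ ω, ENNReal.ofReal (f ω) ∂μ ≠ ∞ ∨ ∫⁻ ω, ENNReal.ofReal (-f ω) ∂μ ≠ ∞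

/-- The extended-real expectation of `f` (meaningful if `ExpectationDefined f μ`). -/
noncomputable def expectation (f : Ω → ℝ) (μ : Measure Ω) : EReal :=
  ((∫⁻ ω, ENNReal.ofReal (f ω) ∂μ : ℝ≥0∞) : EReal)
    - ((∫⁻ ω, ENNReal.ofReal (-f ω) ∂μ : ℝ≥0∞) : EReal)

/-- The Bayes risk `R_ℓ(Y|V)`: the infimum of `E[ℓ(Y, ψ(V))]` over all (measurable) decision rules
`ψ` for which this expectation is defined. -/
noncomputable def condBayesRisk {𝓨 𝓐 𝓥 : Type*} [MeasurableSpace 𝓐] [MeasurableSpace 𝓥]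
    (ℓ : 𝓨 → 𝓐 → ℝ) (Y : Ω → 𝓨) (V : Ω → 𝓥) (μ : Measure Ω) : EReal :=
  ⨅ (ψ : 𝓥 → 𝓐) (_ : Measurable ψ ∧ ExpectationDefined (fun ω => ℓ (Y ω) (ψ (V ω))) μ),
    expectation (fun ω => ℓ (Y ω) (ψ (V ω))) μ

/-- The minimum excess risk `R_ℓ(Y|X,Zⁿ) - R_ℓ(Y|X,W)`; here `D` is the data set `Zⁿ`. -/
noncomputable def minimumExcessRisk {𝓧 𝓨 𝓦 𝓓 𝓐 : Type*} [MeasurableSpace 𝓧] [MeasurableSpace 𝓦]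
    [MeasurableSpace 𝓓] [MeasurableSpace 𝓐] (ℓ : 𝓨 → 𝓐 → ℝ)
    (W : Ω → 𝓦) (D : Ω → 𝓓) (X : Ω → 𝓧) (Y : Ω → 𝓨) (μ : Measure Ω) : EReal :=
  condBayesRisk ℓ Y (fun ω => (X ω, D ω)) μ - condBayesRisk ℓ Y (fun ω => (X ω, W ω)) μ

end Risk

/-! ### Conditional mutual information -/

/-- The conditional mutual information (in nats)
`I(U;V|T) = ∫ D_KL(P_{U,V|T=t} ‖ P_{U|T=t} ⊗ P_{V|T=t}) P_T(dt)`. -/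
noncomputable def condMutualInfo {Ω 𝓤 𝓥 𝓣 : Type*} [MeasurableSpace Ω]
    [MeasurableSpace 𝓤] [StandardBorelSpace 𝓤] [Nonempty 𝓤]
    [MeasurableSpace 𝓥] [StandardBorelSpace 𝓥] [Nonempty 𝓥] [MeasurableSpace 𝓣]
    (U : Ω → 𝓤) (V : Ω → 𝓥) (T : Ω → 𝓣) (μ : Measure Ω) [IsFiniteMeasure μ] : ℝ≥0∞ :=
  ∫⁻ t, InformationTheory.klDiv (condDistrib (fun ω => (U ω, V ω)) T μ t)
    ((condDistrib U T μ t).prod (condDistrib V T μ t)) ∂(μ.map T)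

/-! ### The posterior sample -/

/-- The conditional law of `(Y, W')` given `T = t`, where `W'` is sampled from the posterior
`P_{W|T}` conditionally independently of everything else given `T`. -/
noncomputable def posteriorSampleLaw {Ω 𝓨 𝓦 𝓣 : Type*} [MeasurableSpace Ω]
    [MeasurableSpace 𝓨] [StandardBorelSpace 𝓨] [Nonempty 𝓨]
    [MeasurableSpace 𝓦] [StandardBorelSpace 𝓦] [Nonempty 𝓦] [MeasurableSpace 𝓣]
    (Y : Ω → 𝓨) (W : Ω → 𝓦) (T : Ω → 𝓣) (μ : Measure Ω) [IsFiniteMeasure μ] (t : 𝓣) :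
    Measure (𝓨 × 𝓦) :=
  (condDistrib Y T μ t).prod (condDistrib W T μ t)

/-- One-sided bound on the cumulant generating function of the centered variable:
`log E_Q[exp(-l (L - E_Q L))] ≤ φ l` for `0 ≤ l < b`, all expectations being finite. -/
def HasCGFBound {S : Type*} [MeasurableSpace S] (L : S → ℝ) (Q : Measure S)
    (φ : ℝ → ℝ) (b : EReal) : Prop :=
  Integrable L Q ∧ ∀ l : ℝ, 0 ≤ l → (l : EReal) < b →
    Integrable (fun s => Real.exp (-l * (L s - ∫ r, L r ∂Q))) Q ∧
    Real.log (∫ s, Real.exp (-l * (L s - ∫ r, L r ∂Q)) ∂Q) ≤ φ l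

/-- `L` is `σ²`-subgaussian under `Q`: `E_Q[exp(l (L - E_Q L))] ≤ exp(l² σ² / 2)` for all real `l`,
all expectations being finite. -/
def IsSubgaussian {S : Type*} [MeasurableSpace S] (L : S → ℝ) (Q : Measure S) (σ : ℝ) : Prop :=
  Integrable L Q ∧ ∀ l : ℝ,
    Integrable (fun s => Real.exp (l * (L s - ∫ r, L r ∂Q))) Q ∧
    ∫ s, Real.exp (l * (L s - ∫ r, L r ∂Q)) ∂Q ≤ Real.exp (l ^ 2 * σ ^ 2 / 2)

/-! ### Legendre dual and its generalized inverse -/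

/-- `φ*(γ) = sup_{0 ≤ l < b} (l γ - φ(l))`. -/
noncomputable def legendreDual (φ : ℝ → ℝ) (b : EReal) (γ : ℝ) : EReal :=
  ⨆ (l : ℝ) (_ : 0 ≤ l ∧ (l : EReal) < b), ((l * γ - φ l : ℝ) : EReal)

/-- `φ*⁻¹(u) = sup {γ ∈ ℝ : φ*(γ) ≤ u}`, an extended real number (`+∞` at `u = +∞`). -/
noncomputable def legendreDualInv (φ : ℝ → ℝ) (b : EReal) (u : EReal) : EReal :=
  ⨆ (γ : ℝ) (_ : legendreDual φ b γ ≤ u), (γ : EReal)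

end BayesLearning

/-! Write `T = (X, Zⁿ)` and `U = Ψ(X, W)`. The comparison rule is posterior sampling: given `T`,
draw a copy of `U` from its conditional law, independently of `Y`. Its conditional mean loss `m(T)`
is an integral against the product of the conditional laws of `U` and `Y`, while the omniscient rule
has conditional mean loss `a(T)`, an integral against their joint conditional law. Donsker–Varadhan
applied to `-l (L - E L)` bounds `l (m - a) - φ l` by the divergence between these two laws, for
each admissible `l` (`HasCGFBound.ofReal_le_klDiv`). Averaging over `T` gives `φ*(E m - E a) ≤ I`,
hence `E m - E a ≤ φ*⁻¹(I)`.

Two points need care. Decision rules are deterministic, so the sampled action is derandomized by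
fixing a good value of the auxiliary randomness (`exists_decisionRule_integral_sub_nonpos`).
Moreover `m` need not be integrable: finite `I` controls only its positive part, and a failure of
integrability then makes the risk `⊥`.

The limit at zero and the subgaussian bound are calculations with the Legendre dual. -/

namespace BayesLearning

/-! ### Variational bounds and extended-real expectations. -/

/-- The variational (Donsker–Varadhan) lower bound on the Kullback–Leibler divergence. -/
theorem integral_le_toReal_klDiv_add_log {S : Type*} [MeasurableSpace S] {μ ν : Measure S}
    [IsProbabilityMeasure μ] [IsProbabilityMeasure ν] {f : S → ℝ} (hf : Integrable f μ)
    (hexp : Integrable (fun s => Real.exp (f s)) ν) (h : InformationTheory.klDiv μ ν ≠ ∞) :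
    ∫ s, f s ∂μ ≤ (InformationTheory.klDiv μ ν).toReal
      + Real.log (∫ s, Real.exp (f s) ∂ν) := by
  obtain ⟨hac, hint⟩ := InformationTheory.klDiv_ne_top_iff.1 h
  have := isProbabilityMeasure_tilted hexp
  have h1 := integral_llr_tilted_right hac hf hexp hint
  -- Gibbs' inequality for `μ` against `ν` tilted by `f`; `h1` expands this divergence.
  have h2 := InformationTheory.integral_llr_add_sub_measure_univ_nonneg
    (hac.trans (absolutelyContinuous_tilted hexp)) (integrable_llr_tilted_right hac hf hint hexp)
  rw [InformationTheory.toReal_klDiv_of_measure_eq hac (by simp)]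
  simp only [probReal_univ] at h2
  linarith

/-- A bound on the cumulant generating function at one point bounds the mean deviation. -/
theorem HasCGFBound.lintegral_enorm_sub_le {S : Type*} [MeasurableSpace S] {L : S → ℝ}
    {Q : Measure S} [IsProbabilityMeasure Q] {φ : ℝ → ℝ} {b : EReal} (h : HasCGFBound L Q φ b)
    {l : ℝ} (hl : 0 < l) (hlb : (l : EReal) < b) :
    ∫⁻ s, ‖L s - ∫ r, L r ∂Q‖ₑ ∂Q ≤ ENNReal.ofReal (2 / l * Real.exp (φ l)) := by
  obtain ⟨hL, h⟩ := h
  obtain ⟨hexp, hlog⟩ := h l hl.le hlb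
  have hD : Integrable (fun s => L s - ∫ r, L r ∂Q) Q := hL.sub (integrable_const _)
  rw [← ofReal_integral_norm_eq_lintegral_enorm hD]
  refine ENNReal.ofReal_le_ofReal ?_
  -- `|x| = x + 2x⁻`, and `1 + y ≤ exp y` at `y = -l x` bounds `x⁻`. The linear term has mean zero
  -- after centering.
  have hpt (x : ℝ) : ‖x‖ ≤ x + 2 / l * Real.exp (-l * x) := by
    have h1 := Real.add_one_le_exp (-l * x)
    have h2 := Real.exp_pos (-l * x)
    have h3 : -x ≤ 1 / l * Real.exp (-l * x) := by
      rw [one_div, ← div_eq_inv_mul, le_div_iff₀ hl]; linarith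
    have h4 : 0 ≤ 1 / l * Real.exp (-l * x) := by positivity
    have h5 : 2 / l * Real.exp (-l * x) = 2 * (1 / l * Real.exp (-l * x)) := by ring
    rw [Real.norm_eq_abs, h5]
    exact abs_le'.2 ⟨by linarith, by linarith⟩
  have hpos : 0 < ∫ s, Real.exp (-l * (L s - ∫ r, L r ∂Q)) ∂Q := integral_exp_pos hexp
  calc ∫ s, ‖L s - ∫ r, L r ∂Q‖ ∂Q
      ≤ ∫ s, ((L s - ∫ r, L r ∂Q) + 2 / l * Real.exp (-l * (L s - ∫ r, L r ∂Q))) ∂Q :=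
        integral_mono hD.norm (hD.add (hexp.const_mul _)) fun s => hpt _
    _ = 2 / l * ∫ s, Real.exp (-l * (L s - ∫ r, L r ∂Q)) ∂Q := by
        rw [integral_add hD (hexp.const_mul _), integral_sub hL (integrable_const _),
          integral_const_mul]
        simp
    _ ≤ 2 / l * Real.exp (φ l) := by
        gcongr
        exact (Real.log_le_iff_le_exp hpos).1 hlog

theorem expectation_eq_integral {Ω : Type*} [MeasurableSpace Ω] {μ : Measure Ω} {f : Ω → ℝ}
    (hf : Integrable f μ) : expectation f μ = ((∫ ω, f ω ∂μ : ℝ) : EReal) := by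
  have h1 : ∫⁻ ω, ENNReal.ofReal (f ω) ∂μ ≠ ∞ := (hf.lintegral_lt_top).ne
  have h2 : ∫⁻ ω, ENNReal.ofReal (-f ω) ∂μ ≠ ∞ := (hf.neg.lintegral_lt_top).ne
  rw [integral_eq_lintegral_pos_part_sub_lintegral_neg_part hf, expectation, EReal.coe_sub,
    EReal.coe_ennreal_toReal h1, EReal.coe_ennreal_toReal h2]

theorem integrable_of_lintegral_ofReal_ne_top {Ω : Type*} [MeasurableSpace Ω] {μ : Measure Ω}
    {f : Ω → ℝ} (hf : Measurable f) (h1 : ∫⁻ ω, ENNReal.ofReal (f ω) ∂μ ≠ ∞)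
    (h2 : ∫⁻ ω, ENNReal.ofReal (-f ω) ∂μ ≠ ∞) : Integrable f μ := by
  refine ⟨hf.aestronglyMeasurable, ?_⟩
  have hle : ∫⁻ ω, ‖f ω‖ₑ ∂μ
      ≤ ∫⁻ ω, ENNReal.ofReal (f ω) ∂μ + ∫⁻ ω, ENNReal.ofReal (-f ω) ∂μ := by
    rw [← lintegral_add_left hf.ennreal_ofReal]
    refine lintegral_mono fun ω => ?_
    rw [← ofReal_norm, Real.norm_eq_abs]
    rcases abs_cases (f ω) with h | h
    · rw [h.1]; exact le_self_add
    · rw [h.1]; exact le_add_self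
  exact hle.trans_lt (ENNReal.add_lt_top.2 ⟨h1.lt_top, h2.lt_top⟩)

/-- If the positive part of a loss is integrable, its expectation is defined, and it is `⊥`
unless the loss is integrable. -/
theorem expectation_eq_bot {Ω : Type*} [MeasurableSpace Ω] {μ : Measure Ω} {f : Ω → ℝ}
    (hf : Measurable f) (h1 : ∫⁻ ω, ENNReal.ofReal (f ω) ∂μ ≠ ∞) (h : ¬ Integrable f μ) :
    expectation f μ = ⊥ := by
  have h2 : ∫⁻ ω, ENNReal.ofReal (-f ω) ∂μ = ∞ := by
    by_contra h2
    exact h (integrable_of_lintegral_ofReal_ne_top hf h1 h2)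
  rw [expectation, h2, EReal.coe_ennreal_top, EReal.sub_top]

theorem legendreDualInv_top (φ : ℝ → ℝ) (b : EReal) : legendreDualInv φ b ⊤ = ⊤ := by
  rw [EReal.eq_top_iff_forall_lt]
  intro y
  refine lt_of_lt_of_le (EReal.coe_lt_coe_iff.2 (lt_add_one y)) ?_
  exact le_iSup₂ (f := fun (γ : ℝ) (_ : legendreDual φ b γ ≤ ⊤) => (γ : EReal)) (y + 1) le_top

/-! ### Replacing a randomized rule by a deterministic one. -/

section Derandomization

variable {Ω 𝓨 𝓐 𝓣 : Type*} [MeasurableSpace Ω]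
  [MeasurableSpace 𝓨] [StandardBorelSpace 𝓨] [Nonempty 𝓨]
  [MeasurableSpace 𝓐] [StandardBorelSpace 𝓐] [Nonempty 𝓐] [MeasurableSpace 𝓣]

/-- A randomized decision rule `κ` with conditional mean losses `m` is matched by a deterministic
rule, provided that the conditional mean deviations of the loss are bounded. -/
theorem exists_decisionRule_integral_sub_nonpos (μ : Measure Ω) [IsProbabilityMeasure μ]
    {Y : Ω → 𝓨} {T : Ω → 𝓣} (hY : Measurable Y) (hT : Measurable T) {ℓ : 𝓨 → 𝓐 → ℝ}
    (hℓ : Measurable (Function.uncurry ℓ)) (κ : Kernel 𝓣 𝓐) [IsMarkovKernel κ] {m : 𝓣 → ℝ}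
    (hm : Measurable m) (C : ℝ)
    (h : ∀ᵐ t ∂(μ.map T),
      Integrable (fun p : 𝓐 × 𝓨 => ℓ p.2 p.1) ((κ t).prod (condDistrib Y T μ t)) ∧
      ∫ p, ℓ p.2 p.1 ∂((κ t).prod (condDistrib Y T μ t)) = m t ∧
      ∫⁻ p, ‖ℓ p.2 p.1 - m t‖ₑ ∂((κ t).prod (condDistrib Y T μ t)) ≤ ENNReal.ofReal C) :
    ∃ ψ : 𝓣 → 𝓐, Measurable ψ ∧ Integrable (fun ω => ℓ (Y ω) (ψ (T ω)) - m (T ω)) μ ∧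
      ∫ ω, (ℓ (Y ω) (ψ (T ω)) - m (T ω)) ∂μ ≤ 0 := by
  have hℓ' : Measurable (fun p : 𝓨 × 𝓐 => ℓ p.1 p.2) := hℓ
  obtain ⟨f, hf, hfκ⟩ := Kernel.exists_measurable_map_eq_unitInterval κ
  have hf' : Measurable (fun p : 𝓣 × unitInterval => f p.1 p.2) := hf
  have hprob : IsProbabilityMeasure (μ.map T) := Measure.isProbabilityMeasure_map hT.aemeasurable
  -- The kernel is realized as `f t v` with `v` uniform. Subtracting `m` matters: the deviations are
  -- integrable by the uniform bound `C`, whereas the loss itself may not be.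
  set F : (𝓣 × 𝓨) × unitInterval → ℝ := fun p => ℓ p.1.2 (f p.1.1 p.2) - m p.1.1 with hF
  have hFm : Measurable F := by
    refine Measurable.sub ?_ (by fun_prop)
    exact hℓ'.comp (measurable_fst.snd.prodMk
      (hf'.comp (measurable_fst.fst.prodMk measurable_snd)))
  have hκt (t : 𝓣) : (κ t).prod (condDistrib Y T μ t)
      = (((volume : Measure unitInterval).prod (condDistrib Y T μ t)).map
        (fun p : unitInterval × 𝓨 => (f t p.1, p.2))) := by
    have hft : Measurable (f t) := hf.of_uncurry_left
    rw [← hfκ t]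
    conv_lhs => rw [← Measure.map_id (μ := condDistrib Y T μ t)]
    rw [Measure.map_prod_map _ _ hft measurable_id]
    rfl
  have hmap (t : 𝓣) : Measurable (fun p : unitInterval × 𝓨 => (f t p.1, p.2)) := by
    have hft : Measurable (f t) := hf.of_uncurry_left
    fun_prop
  have hℓs : Measurable (fun p : 𝓐 × 𝓨 => ℓ p.2 p.1) := hℓ'.comp measurable_swap
  have hsm (t : 𝓣) : AEStronglyMeasurable (fun p : 𝓐 × 𝓨 => ℓ p.2 p.1)
      (((volume : Measure unitInterval).prod (condDistrib Y T μ t)).map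
        (fun p : unitInterval × 𝓨 => (f t p.1, p.2))) := hℓs.aestronglyMeasurable
  have hFint : Integrable F (((μ.map T) ⊗ₘ condDistrib Y T μ).prod volume) := by
    refine ⟨hFm.aestronglyMeasurable, ?_⟩
    refine lt_of_le_of_lt ?_ (ENNReal.ofReal_lt_top (r := C))
    rw [lintegral_prod _ hFm.enorm.aemeasurable,
      Measure.lintegral_compProd hFm.enorm.lintegral_prod_right']
    calc _ ≤ ∫⁻ _, ENNReal.ofReal C ∂(μ.map T) := by
          refine lintegral_mono_ae ?_
          filter_upwards [h] with t ht
          refine le_trans (le_of_eq ?_) ht.2.2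
          have hFt : Measurable (fun p : unitInterval × 𝓨 => F ((t, p.2), p.1)) := by fun_prop
          rw [hκt, lintegral_map (hℓs.sub_const _).enorm (hmap t),
            lintegral_prod_symm _ hFt.enorm.aemeasurable]
      _ = _ := by simp
  have hFzero : ∫ p, F p ∂(((μ.map T) ⊗ₘ condDistrib Y T μ).prod volume) = 0 := by
    rw [integral_prod _ hFint, Measure.integral_compProd hFint.integral_prod_left]
    refine integral_eq_zero_of_ae ?_
    filter_upwards [h] with t ht
    obtain ⟨h1, h2, -⟩ := ht
    rw [hκt] at h1 h2
    rw [integrable_map_measure (hsm t) (hmap t).aemeasurable] at h1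
    rw [integral_map (hmap t).aemeasurable (hsm t)] at h2
    have h3 := integral_prod_symm
      (fun p : unitInterval × 𝓨 => F ((t, p.2), p.1)) (h1.sub (integrable_const (m t)))
    have h4 : ∫ p : unitInterval × 𝓨, F ((t, p.2), p.1) ∂(volume.prod (condDistrib Y T μ t))
        = 0 := by
      simp only [hF]
      refine (integral_sub h1 (integrable_const (m t))).trans ?_
      simp only [Function.comp_apply, h2]
      simp
    rw [h4] at h3
    exact h3.symm
  -- Some seed `v` does no worse than the average over seeds, which is zero; it can be taken outside
  -- the null set where the section of `F` is not integrable.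
  obtain ⟨v, hv, hle⟩ := exists_notMem_null_le_integral hFint.integral_prod_right
    (ae_iff.1 hFint.prod_left_ae)
  have hv : Integrable (fun p => F (p, v)) ((μ.map T) ⊗ₘ condDistrib Y T μ) := by
    simpa using hv
  rw [← integral_prod_symm F hFint, hFzero] at hle
  rw [compProd_map_condDistrib hY.aemeasurable] at hv hle
  have hTY : Measurable (fun ω => (T ω, Y ω)) := hT.prodMk hY
  have hFv : AEStronglyMeasurable (fun p => F (p, v)) (μ.map fun ω => (T ω, Y ω)) :=
    (hFm.comp (measurable_id.prodMk measurable_const)).aestronglyMeasurable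
  rw [integrable_map_measure hFv hTY.aemeasurable] at hv
  rw [integral_map hTY.aemeasurable hFv] at hle
  exact ⟨fun t => f t v, hf.of_uncurry_right, hv, hle⟩

end Derandomization

/-! ### The information bound for a general action `U`. -/

section RiskBound

variable {Ω 𝓨 𝓐 𝓣 : Type*} [MeasurableSpace Ω]
  [MeasurableSpace 𝓨] [StandardBorelSpace 𝓨] [Nonempty 𝓨]
  [MeasurableSpace 𝓐] [StandardBorelSpace 𝓐] [Nonempty 𝓐] [MeasurableSpace 𝓣]

/-- The pointwise estimate: under a bound on the cumulant generating function of `L` under `Q`,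
the means of `L` under `Q` and `J` differ by an amount controlled by `D_KL(J ‖ Q)`. -/
theorem HasCGFBound.ofReal_le_klDiv {S : Type*} [MeasurableSpace S] {L : S → ℝ}
    {J Q : Measure S} [IsProbabilityMeasure J] [IsProbabilityMeasure Q] {φ : ℝ → ℝ} {b : EReal}
    (h : HasCGFBound L Q φ b) (hJ : Integrable L J) {l : ℝ} (hl : 0 ≤ l) (hlb : (l : EReal) < b) :
    ENNReal.ofReal (l * (∫ s, L s ∂Q - ∫ s, L s ∂J) - φ l) ≤ InformationTheory.klDiv J Q := by
  by_cases hkl : InformationTheory.klDiv J Q = ∞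
  · simp [hkl]
  obtain ⟨hexp, hlog⟩ := h.2 l hl hlb
  have hf : Integrable (fun s => -l * (L s - ∫ r, L r ∂Q)) J :=
    (hJ.sub (integrable_const _)).const_mul _
  have h1 := integral_le_toReal_klDiv_add_log hf hexp hkl
  rw [integral_const_mul, integral_sub hJ (integrable_const _)] at h1
  simp only [integral_const, probReal_univ, smul_eq_mul, one_mul] at h1
  rw [← ENNReal.ofReal_toReal hkl]
  refine ENNReal.ofReal_le_ofReal ?_
  linarith

/-- A decision rule based on `T` alone has a risk exceeding that of the action `U` by at most
`φ*⁻¹(I(U;Y|T))`. -/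
theorem condBayesRisk_sub_integral_le (μ : Measure Ω) [IsProbabilityMeasure μ]
    {U : Ω → 𝓐} {Y : Ω → 𝓨} {T : Ω → 𝓣} (hU : Measurable U) (hY : Measurable Y)
    (hT : Measurable T) {ℓ : 𝓨 → 𝓐 → ℝ} (hℓ : Measurable (Function.uncurry ℓ))
    (hint : Integrable (fun ω => ℓ (Y ω) (U ω)) μ) {b : EReal} {φ : ℝ → ℝ} (hb : 0 < b)
    (h : ∀ᵐ t ∂(μ.map T), HasCGFBound (fun p : 𝓐 × 𝓨 => ℓ p.2 p.1)
      ((condDistrib U T μ t).prod (condDistrib Y T μ t)) φ b) :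
    condBayesRisk ℓ Y T μ - ((∫ ω, ℓ (Y ω) (U ω) ∂μ : ℝ) : EReal)
      ≤ legendreDualInv φ b ((condMutualInfo U Y T μ : ℝ≥0∞) : EReal) := by
  by_cases hI : condMutualInfo U Y T μ = ∞
  · rw [hI, EReal.coe_ennreal_top, legendreDualInv_top]
    exact le_top
  have hprob : IsProbabilityMeasure (μ.map T) := Measure.isProbabilityMeasure_map hT.aemeasurable
  have hℓ' : Measurable (fun p : 𝓨 × 𝓐 => ℓ p.1 p.2) := hℓ
  have hℓs : Measurable (fun p : 𝓐 × 𝓨 => ℓ p.2 p.1) := hℓ'.comp measurable_swap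
  have hUY : Measurable (fun ω => (U ω, Y ω)) := hU.prodMk hY
  have hTUY : Measurable (fun ω => (T ω, (U ω, Y ω))) := hT.prodMk hUY
  -- the conditional means of the loss under the product law and under the joint law
  set m : 𝓣 → ℝ := fun t => ∫ p, ℓ p.2 p.1 ∂((condDistrib U T μ t).prod (condDistrib Y T μ t))
    with hm_def
  set a : 𝓣 → ℝ := fun t => ∫ p, ℓ p.2 p.1 ∂(condDistrib (fun ω => (U ω, Y ω)) T μ t) with ha_def
  have hm : Measurable m := by
    have h1 : StronglyMeasurable fun t =>
        ∫ p, ℓ p.2 p.1 ∂((condDistrib U T μ ×ₖ condDistrib Y T μ) t) :=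
      StronglyMeasurable.integral_kernel_prod_right'
        (f := fun q : 𝓣 × 𝓐 × 𝓨 => ℓ q.2.2 q.2.1)
        (hℓs.comp measurable_snd).stronglyMeasurable
    simpa only [Kernel.prod_apply] using h1.measurable
  have ha : Measurable a :=
    (StronglyMeasurable.integral_condDistrib (f := fun q : 𝓣 × 𝓐 × 𝓨 => ℓ q.2.2 q.2.1)
        (hℓs.comp measurable_snd).stronglyMeasurable).measurable
  have hintm : Integrable (fun q : 𝓣 × 𝓐 × 𝓨 => ℓ q.2.2 q.2.1)
      (μ.map fun ω => (T ω, (U ω, Y ω))) :=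
    (integrable_map_measure (hℓs.comp measurable_snd).aestronglyMeasurable hTUY.aemeasurable).2 hint
  have hJ : ∀ᵐ t ∂(μ.map T), Integrable (fun p : 𝓐 × 𝓨 => ℓ p.2 p.1)
      (condDistrib (fun ω => (U ω, Y ω)) T μ t) := hintm.condDistrib_ae_map hUY.aemeasurable
  have ha_int : Integrable a (μ.map T) := hintm.integral_condDistrib_map hUY.aemeasurable
  have ha_eq : ∫ t, a t ∂(μ.map T) = ∫ ω, ℓ (Y ω) (U ω) ∂μ := by
    rw [← compProd_map_condDistrib hUY.aemeasurable] at hintm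
    rw [ha_def, ← Measure.integral_compProd hintm, compProd_map_condDistrib hUY.aemeasurable]
    exact integral_map hTUY.aemeasurable (hℓs.comp measurable_snd).aestronglyMeasurable
  have hg (l : ℝ) (hl : 0 ≤ l) (hlb : (l : EReal) < b) :
      ∫⁻ t, ENNReal.ofReal (l * (m t - a t) - φ l) ∂(μ.map T) ≤ condMutualInfo U Y T μ := by
    refine lintegral_mono_ae ?_
    filter_upwards [h, hJ] with t ht htJ
    exact ht.ofReal_le_klDiv htJ hl hlb
  obtain ⟨l₀, hl₀, hl₀b⟩ : ∃ l : ℝ, 0 < l ∧ (l : EReal) < b := by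
    obtain ⟨l, h1, h2⟩ := EReal.lt_iff_exists_real_btwn.1 hb
    exact ⟨l, by exact_mod_cast h1, h2⟩
  -- Split `m = (a + φ l₀ / l₀) + (l₀ (m - a) - φ l₀) / l₀`: the first term is integrable, and the
  -- positive part of `l₀ (m - a) - φ l₀` has integral at most `I < ∞`.
  have hm_pos : ∫⁻ t, ENNReal.ofReal (m t) ∂(μ.map T) ≠ ∞ := by
    have hc : Integrable (fun t => a t + φ l₀ / l₀) (μ.map T) := ha_int.add (integrable_const _)
    have hle : ∫⁻ t, ENNReal.ofReal (m t) ∂(μ.map T)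
        ≤ ∫⁻ t, ENNReal.ofReal (a t + φ l₀ / l₀) ∂(μ.map T)
          + ENNReal.ofReal (1 / l₀) * condMutualInfo U Y T μ := by
      calc ∫⁻ t, ENNReal.ofReal (m t) ∂(μ.map T)
          ≤ ∫⁻ t, (ENNReal.ofReal (a t + φ l₀ / l₀) + ENNReal.ofReal (1 / l₀) *
              ENNReal.ofReal (l₀ * (m t - a t) - φ l₀)) ∂(μ.map T) := by
            refine lintegral_mono fun t => ?_
            rw [← ENNReal.ofReal_mul (by positivity)]
            refine le_trans (ENNReal.ofReal_le_ofReal (le_of_eq ?_)) ENNReal.ofReal_add_le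
            field_simp
            ring
        _ ≤ _ := by
            rw [lintegral_add_left (by fun_prop), lintegral_const_mul _ (by fun_prop)]
            gcongr
            exact hg l₀ hl₀.le hl₀b
    refine (hle.trans_lt (ENNReal.add_lt_top.2 ⟨hc.lintegral_lt_top, ?_⟩)).ne
    exact ENNReal.mul_lt_top ENNReal.ofReal_lt_top (lt_top_iff_ne_top.2 hI)
  obtain ⟨ψ, hψ, hD, hD0⟩ := exists_decisionRule_integral_sub_nonpos μ hY hT hℓ
    (condDistrib U T μ) hm (2 / l₀ * Real.exp (φ l₀)) (by
      filter_upwards [h] with t ht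
      exact ⟨ht.1, rfl, ht.lintegral_enorm_sub_le hl₀ hl₀b⟩)
  have hloss : Measurable fun ω => ℓ (Y ω) (ψ (T ω)) := hℓ'.comp (hY.prodMk (hψ.comp hT))
  have hloss_pos : ∫⁻ ω, ENNReal.ofReal (ℓ (Y ω) (ψ (T ω))) ∂μ ≠ ∞ := by
    have hle : ∫⁻ ω, ENNReal.ofReal (ℓ (Y ω) (ψ (T ω))) ∂μ
        ≤ ∫⁻ ω, ENNReal.ofReal (ℓ (Y ω) (ψ (T ω)) - m (T ω)) ∂μ
          + ∫⁻ t, ENNReal.ofReal (m t) ∂(μ.map T) := by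
      rw [lintegral_map (by fun_prop) hT, ← lintegral_add_right _ (by fun_prop)]
      refine lintegral_mono fun ω => ?_
      refine le_trans (ENNReal.ofReal_le_ofReal (le_of_eq ?_)) ENNReal.ofReal_add_le
      ring
    exact (hle.trans_lt (ENNReal.add_lt_top.2
      ⟨hD.lintegral_lt_top, lt_top_iff_ne_top.2 hm_pos⟩)).ne
  have hR : condBayesRisk ℓ Y T μ ≤ expectation (fun ω => ℓ (Y ω) (ψ (T ω))) μ :=
    iInf₂_le ψ ⟨hψ, Or.inl hloss_pos⟩
  -- The positive part of the loss is already integrable, so non-integrability means mean `-∞`, and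
  -- the bound is trivial.
  by_cases hloss_int : Integrable (fun ω => ℓ (Y ω) (ψ (T ω))) μ
  swap
  · rw [expectation_eq_bot hloss hloss_pos hloss_int, le_bot_iff] at hR
    rw [hR, EReal.bot_sub]
    exact bot_le
  have hmT : Integrable (fun ω => m (T ω)) μ := by
    refine (hloss_int.sub hD).congr (ae_of_all _ fun ω => ?_)
    simp
  have hm_int : Integrable m (μ.map T) :=
    (integrable_map_measure hm.aestronglyMeasurable hT.aemeasurable).2 hmT
  rw [expectation_eq_integral hloss_int] at hR
  rw [integral_sub hloss_int hmT,
    ← integral_map (f := m) hT.aemeasurable hm.aestronglyMeasurable] at hD0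
  have hγ : legendreDual φ b (∫ t, m t ∂(μ.map T) - ∫ t, a t ∂(μ.map T))
      ≤ ((condMutualInfo U Y T μ : ℝ≥0∞) : EReal) := by
    refine iSup₂_le fun l hl => ?_
    have hma : Integrable (fun t => m t - a t) (μ.map T) := hm_int.sub ha_int
    have hgi : Integrable (fun t => l * (m t - a t) - φ l) (μ.map T) :=
      (hma.const_mul l).sub (integrable_const _)
    have heq : ∫ t, (l * (m t - a t) - φ l) ∂(μ.map T)
        = l * (∫ t, m t ∂(μ.map T) - ∫ t, a t ∂(μ.map T)) - φ l := by
      rw [integral_sub (hma.const_mul l) (integrable_const _),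
        integral_const_mul, integral_sub hm_int ha_int]
      simp
    rw [← EReal.coe_ennreal_toReal hI, EReal.coe_le_coe_iff, ← heq,
      integral_eq_lintegral_pos_part_sub_lintegral_neg_part hgi]
    -- The bound `hg` controls the positive part; discarding the negative part only enlarges the
    -- integral.
    have h1 := ENNReal.toReal_mono hI (hg l hl.1 hl.2)
    have h2 : 0 ≤ (∫⁻ t, ENNReal.ofReal (-(l * (m t - a t) - φ l)) ∂(μ.map T)).toReal :=
      ENNReal.toReal_nonneg
    linarith
  refine le_trans ?_ (le_iSup₂ (f := fun (γ : ℝ)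
    (_ : legendreDual φ b γ ≤ ((condMutualInfo U Y T μ : ℝ≥0∞) : EReal)) => (γ : EReal)) _ hγ)
  rw [ha_eq, EReal.coe_sub]
  refine EReal.sub_le_sub (hR.trans ?_) le_rfl
  rw [EReal.coe_le_coe_iff]
  linarith

end RiskBound

/-! ### Generalized inverse of the Legendre dual. -/

section Legendre

/-- A function that is convex on `(0,b)` with value and right derivative `0` at `0` is
nonnegative on `[0,b)`. -/
theorem nonneg_of_convexOn_of_hasDerivWithinAt {φ : ℝ → ℝ} {b : EReal}
    (hφ : ConvexOn ℝ {l : ℝ | 0 < l ∧ (l : EReal) < b} φ) (h0 : φ 0 = 0)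
    (hd : HasDerivWithinAt φ 0 (Set.Ici 0) 0) {l : ℝ} (hl : 0 ≤ l) (hlb : (l : EReal) < b) :
    0 ≤ φ l := by
  rcases hl.eq_or_lt with rfl | hl
  · exact h0.ge
  have hmem {s : ℝ} (hs : 0 < s) (hsl : s ≤ l) : s ∈ {l : ℝ | 0 < l ∧ (l : EReal) < b} :=
    ⟨hs, (EReal.coe_le_coe_iff.2 hsl).trans_lt hlb⟩
  have hd' : HasDerivWithinAt φ 0 (Set.Ioi 0) 0 := hd.mono Set.Ioi_subset_Ici_self
  have hcont : Tendsto φ (𝓝[>] 0) (𝓝 0) := by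
    simpa [ContinuousWithinAt, h0] using hd'.continuousWithinAt
  have hslope : Tendsto (fun s => φ s / s) (𝓝[>] 0) (𝓝 0) := by
    have h1 := (hasDerivWithinAt_iff_tendsto_slope' (by simp)).1 hd'
    refine h1.congr fun s => ?_
    simp [slope_def_field, h0]
  -- Convexity is available only on the open interval, so slopes over `r < s < l` are compared and
  -- `r` tends to `0`, using `φ r → 0`. Letting `s` tend to `0` as well then gives `0 ≤ φ l / l`.
  have hstep {s : ℝ} (hs : 0 < s) (hsl : s < l) : φ s / s ≤ (φ l - φ s) / (l - s) := by
    have h1 : Tendsto (fun r => (φ s - φ r) / (s - r)) (𝓝[>] 0) (𝓝 ((φ s - 0) / (s - 0))) :=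
      (tendsto_const_nhds.sub hcont).div
        (tendsto_const_nhds.sub (tendsto_nhdsWithin_of_tendsto_nhds tendsto_id))
        (by simpa using hs.ne')
    rw [sub_zero, sub_zero] at h1
    refine le_of_tendsto h1 ?_
    filter_upwards [Ioo_mem_nhdsGT hs] with r hr
    exact hφ.slope_mono_adjacent (hmem hr.1 (hr.2.trans hsl).le) (hmem hl le_rfl) hr.2 hsl
  have h2 : Tendsto (fun s => (φ l - φ s) / (l - s)) (𝓝[>] 0) (𝓝 ((φ l - 0) / (l - 0))) :=
    (tendsto_const_nhds.sub hcont).div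
      (tendsto_const_nhds.sub (tendsto_nhdsWithin_of_tendsto_nhds tendsto_id))
      (by simpa using hl.ne')
  rw [sub_zero, sub_zero] at h2
  have h3 : 0 ≤ φ l / l := by
    refine le_of_tendsto_of_tendsto hslope h2 ?_
    filter_upwards [Ioo_mem_nhdsGT hl] with s hs
    exact hstep hs.1 hs.2
  have h4 := mul_nonneg h3 hl.le
  rwa [div_mul_cancel₀ _ hl.ne'] at h4

/-- A single admissible `l` suffices: `l γ - φ l ≤ x` can be solved for `γ`. -/
theorem legendreDualInv_le_of_lt {φ : ℝ → ℝ} {b : EReal} {l : ℝ} (hl : 0 < l)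
    (hlb : (l : EReal) < b) (x : ℝ) :
    legendreDualInv φ b (x : EReal) ≤ (((x + φ l) / l : ℝ) : EReal) := by
  refine iSup₂_le fun γ hγ => ?_
  have h1 : ((l * γ - φ l : ℝ) : EReal) ≤ x :=
    (le_iSup₂ (f := fun (l : ℝ) (_ : 0 ≤ l ∧ (l : EReal) < b) => ((l * γ - φ l : ℝ) : EReal))
      l ⟨hl.le, hlb⟩).trans hγ
  rw [EReal.coe_le_coe_iff] at h1 ⊢
  rw [le_div_iff₀ hl]
  linarith

theorem tendsto_legendreDualInv {φ : ℝ → ℝ} {b : EReal} (hb : 0 < b)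
    (hφ : ConvexOn ℝ {l : ℝ | 0 < l ∧ (l : EReal) < b} φ) (h0 : φ 0 = 0)
    (hd : HasDerivWithinAt φ 0 (Set.Ici 0) 0) :
    Tendsto (fun x : ℝ => legendreDualInv φ b (x : EReal)) (𝓝[>] 0) (𝓝 0) := by
  have hslope : Tendsto (fun s => φ s / s) (𝓝[>] 0) (𝓝 0) := by
    have h1 := (hasDerivWithinAt_iff_tendsto_slope' (by simp)).1
      (hd.mono (Set.Ioi_subset_Ici_self (a := 0)))
    refine h1.congr fun s => ?_
    simp [slope_def_field, h0]
  obtain ⟨l₀, hl₀, hl₀b⟩ := EReal.lt_iff_exists_real_btwn.1 hb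
  have hl₀ : 0 < l₀ := by exact_mod_cast hl₀
  refine tendsto_order.2 ⟨fun c hc => ?_, fun c hc => ?_⟩
  -- Since `φ ≥ 0`, `φ*(0) ≤ 0`, so `γ = 0` competes in the supremum.
  · filter_upwards [self_mem_nhdsWithin] with x (hx : 0 < x)
    refine hc.trans_le ?_
    refine le_iSup₂ (f := fun (γ : ℝ) (_ : legendreDual φ b γ ≤ (x : EReal)) => (γ : EReal)) 0 ?_
    refine iSup₂_le fun l hl => ?_
    have := nonneg_of_convexOn_of_hasDerivWithinAt hφ h0 hd hl.1 hl.2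
    rw [EReal.coe_le_coe_iff]
    linarith
  · obtain ⟨ε, hε, hεc⟩ := EReal.lt_iff_exists_real_btwn.1 hc
    have hε : 0 < ε := by exact_mod_cast hε
    -- Fix `l` with `φ l / l < ε / 2`; then `x < l ε / 2` makes `(x + φ l) / l < ε`.
    obtain ⟨l, hlε, hl⟩ := ((hslope.eventually_lt_const (half_pos hε)).and
      (Ioo_mem_nhdsGT hl₀)).exists
    have hlb : (l : EReal) < b := (EReal.coe_lt_coe_iff.2 hl.2).trans hl₀b
    filter_upwards [Ioo_mem_nhdsGT (mul_pos hl.1 (half_pos hε))] with x hx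
    refine (legendreDualInv_le_of_lt hl.1 hlb x).trans_lt (lt_of_le_of_lt ?_ hεc)
    rw [EReal.coe_le_coe_iff, add_div]
    have : x / l ≤ ε / 2 := by
      rw [div_le_iff₀ hl.1]
      linarith [hx.2]
    linarith

theorem legendreDualInv_sq_le {σ : ℝ} (hσ : 0 < σ) (I : ℝ≥0∞) :
    legendreDualInv (fun l => l ^ 2 * σ ^ 2 / 2) ⊤ (I : EReal)
      ≤ (((2 * ENNReal.ofReal (σ ^ 2) * I) ^ (1 / 2 : ℝ) : ℝ≥0∞) : EReal) := by
  by_cases hI : I = ∞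
  · have h1 : 2 * ENNReal.ofReal (σ ^ 2) * ∞ = ∞ :=
      ENNReal.mul_top (mul_ne_zero two_ne_zero (by simpa using hσ.ne'))
    rw [hI, h1, ENNReal.top_rpow_of_pos (by norm_num)]
    exact le_top
  refine iSup₂_le fun γ hγ => ?_
  rcases le_or_gt γ 0 with h0 | h0
  · exact (EReal.coe_nonpos.2 h0).trans (EReal.coe_ennreal_nonneg _)
  -- The maximizer of `l γ - l² σ² / 2` is `l = γ / σ²`, with value `γ² / (2σ²)`.
  have h1 : ((γ / σ ^ 2 * γ - (γ / σ ^ 2) ^ 2 * σ ^ 2 / 2 : ℝ) : EReal) ≤ I :=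
    (le_iSup₂ (f := fun (l : ℝ) (_ : 0 ≤ l ∧ (l : EReal) < ⊤) =>
      ((l * γ - l ^ 2 * σ ^ 2 / 2 : ℝ) : EReal)) (γ / σ ^ 2)
      ⟨by positivity, EReal.coe_lt_top _⟩).trans hγ
  rw [← EReal.coe_ennreal_toReal hI, EReal.coe_le_coe_iff] at h1
  have h2 : γ ^ 2 ≤ 2 * σ ^ 2 * I.toReal := by
    have h3 : γ / σ ^ 2 * γ - (γ / σ ^ 2) ^ 2 * σ ^ 2 / 2 = γ ^ 2 / (2 * σ ^ 2) := by
      field_simp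
      ring
    rw [h3, div_le_iff₀ (by positivity)] at h1
    linarith
  have h4 : ENNReal.ofReal γ ≤ (2 * ENNReal.ofReal (σ ^ 2) * I) ^ (1 / 2 : ℝ) := by
    rw [one_div, ENNReal.le_rpow_inv_iff (by norm_num), ENNReal.rpow_two,
      ← ENNReal.ofReal_pow h0.le]
    refine (ENNReal.ofReal_le_ofReal h2).trans (le_of_eq ?_)
    rw [ENNReal.ofReal_mul (by positivity), ENNReal.ofReal_mul (by positivity),
      ENNReal.ofReal_toReal hI, ENNReal.ofReal_ofNat]
  calc (γ : EReal) = ((ENNReal.ofReal γ : ℝ≥0∞) : EReal) := by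
        rw [EReal.coe_ennreal_ofReal, max_eq_left h0.le]
    _ ≤ _ := EReal.coe_ennreal_le_coe_ennreal_iff.2 h4

theorem IsSubgaussian.hasCGFBound {S : Type*} [MeasurableSpace S] {L : S → ℝ} {Q : Measure S}
    [IsProbabilityMeasure Q] {σ : ℝ} (h : IsSubgaussian L Q σ) :
    HasCGFBound L Q (fun l => l ^ 2 * σ ^ 2 / 2) ⊤ := by
  refine ⟨h.1, fun l _ _ => ⟨(h.2 (-l)).1, ?_⟩⟩
  rw [Real.log_le_iff_le_exp (integral_exp_pos (h.2 (-l)).1)]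
  simpa using (h.2 (-l)).2

end Legendre

/-! ### From the posterior of `W` to the conditional law of the action. -/

section Posterior

variable {Ω 𝓧 𝓨 𝓦 𝓐 𝓓 : Type*} [MeasurableSpace Ω] [MeasurableSpace 𝓧]
  [MeasurableSpace 𝓨] [StandardBorelSpace 𝓨] [Nonempty 𝓨]
  [MeasurableSpace 𝓦] [StandardBorelSpace 𝓦] [Nonempty 𝓦]
  [MeasurableSpace 𝓐] [StandardBorelSpace 𝓐] [Nonempty 𝓐] [MeasurableSpace 𝓓]

/-- Given `T`, the conditional law of a function of `W` and `T` is the image of the conditional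
law of `W`. -/
theorem condDistrib_comp_prodMk {𝓣 : Type*} [MeasurableSpace 𝓣] (μ : Measure Ω)
    [IsProbabilityMeasure μ] {W : Ω → 𝓦} {T : Ω → 𝓣} (hW : Measurable W) (hT : Measurable T)
    {f : 𝓣 → 𝓦 → 𝓐} (hf : Measurable (Function.uncurry f)) :
    ∀ᵐ t ∂(μ.map T), condDistrib (fun ω => f (T ω) (W ω)) T μ t
      = (condDistrib W T μ t).map (f t) := by
  have hf' : Measurable (fun p : 𝓣 × 𝓦 => f p.1 p.2) := hf
  have hprob : IsProbabilityMeasure (μ.map T) := Measure.isProbabilityMeasure_map hT.aemeasurable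
  have hU : Measurable fun ω => f (T ω) (W ω) := hf'.comp (hT.prodMk hW)
  -- Building the candidate from `Kernel.id` makes its measurability in `t` automatic;
  -- almost-everywhere uniqueness of conditional laws then identifies it.
  set κ : Kernel 𝓣 𝓐 := (Kernel.id ×ₖ condDistrib W T μ).map (fun p : 𝓣 × 𝓦 => f p.1 p.2)
  have hκt (t : 𝓣) : κ t = (condDistrib W T μ t).map (f t) := by
    rw [Kernel.map_apply _ hf', Kernel.prod_apply, Kernel.id_apply, Measure.dirac_prod,
      Measure.map_map hf' measurable_prodMk_left]
    rfl
  have hκ : μ.map (fun ω => (T ω, f (T ω) (W ω))) = μ.map T ⊗ₘ κ := by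
    refine Measure.ext_of_lintegral _ fun g hg => ?_
    have hfg : Measurable fun p : 𝓣 × 𝓦 => g (p.1, f p.1 p.2) := by fun_prop
    rw [lintegral_map hg (hT.prodMk hU), Measure.lintegral_compProd hg]
    calc ∫⁻ ω, g (T ω, f (T ω) (W ω)) ∂μ
        = ∫⁻ p, g (p.1, f p.1 p.2) ∂(μ.map fun ω => (T ω, W ω)) :=
          (lintegral_map hfg (hT.prodMk hW)).symm
      _ = ∫⁻ t, ∫⁻ w, g (t, f t w) ∂(condDistrib W T μ t) ∂(μ.map T) := by
          rw [← compProd_map_condDistrib hW.aemeasurable, Measure.lintegral_compProd hfg]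
      _ = _ := by
          refine lintegral_congr fun t => ?_
          rw [hκt]
          exact (lintegral_map (hg.comp measurable_prodMk_left) hf.of_uncurry_left).symm
  filter_upwards [condDistrib_ae_eq_of_measure_eq_compProd T hU.aemeasurable hκ] with t ht
  rw [ht, hκt]

theorem HasCGFBound.of_comp {S S' : Type*} [MeasurableSpace S] [MeasurableSpace S'] {L : S' → ℝ}
    {Q : Measure S} {g : S → S'} {φ : ℝ → ℝ} {b : EReal} (hL : Measurable L) (hg : Measurable g)
    (h : HasCGFBound (fun s => L (g s)) Q φ b) : HasCGFBound L (Q.map g) φ b := by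
  have hi : ∫ s, L s ∂(Q.map g) = ∫ s, L (g s) ∂Q :=
    integral_map hg.aemeasurable hL.aestronglyMeasurable
  refine ⟨(integrable_map_measure hL.aestronglyMeasurable hg.aemeasurable).2 h.1,
    fun l hl hlb => ?_⟩
  have hm : AEStronglyMeasurable (fun s => Real.exp (-l * (L s - ∫ r, L r ∂(Q.map g))))
      (Q.map g) := by
    have : Measurable fun s => Real.exp (-l * (L s - ∫ r, L r ∂(Q.map g))) := by fun_prop
    exact this.aestronglyMeasurable
  rw [integral_map hg.aemeasurable hm, integrable_map_measure hm hg.aemeasurable, hi]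
  exact h.2 l hl hlb

/-- Optimality of `Ψ` turns the omniscient risk into the mean loss of `U = Ψ(X, W)`. Since `X` is a
component of `T`, the conditional law of `U` is the image of the posterior under `Ψ t.1`, which
carries the hypothesis on `(Y, W')` over to the product law of `U` and `Y`. -/
theorem minimumExcessRisk_le_legendreDualInv (μ : Measure Ω) [IsProbabilityMeasure μ]
    {W : Ω → 𝓦} {D : Ω → 𝓓} {X : Ω → 𝓧} {Y : Ω → 𝓨}
    (hW : Measurable W) (hD : Measurable D) (hX : Measurable X) (hY : Measurable Y)
    {ℓ : 𝓨 → 𝓐 → ℝ} (hℓ : Measurable (Function.uncurry ℓ))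
    {Ψ : 𝓧 → 𝓦 → 𝓐} (hΨ : Measurable (Function.uncurry Ψ))
    (hΨ_int : Integrable (fun ω => ℓ (Y ω) (Ψ (X ω) (W ω))) μ)
    (hΨ_opt : ((∫ ω, ℓ (Y ω) (Ψ (X ω) (W ω)) ∂μ : ℝ) : EReal)
      = condBayesRisk ℓ Y (fun ω => (X ω, W ω)) μ)
    {b : EReal} {φ : ℝ → ℝ} (hb : 0 < b)
    (h : ∀ᵐ t ∂(μ.map (fun ω => (X ω, D ω))),
      HasCGFBound (fun q : 𝓨 × 𝓦 => ℓ q.1 (Ψ t.1 q.2))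
        (posteriorSampleLaw Y W (fun ω => (X ω, D ω)) μ t) φ b) :
    minimumExcessRisk ℓ W D X Y μ ≤ legendreDualInv φ b
      ((condMutualInfo (fun ω => Ψ (X ω) (W ω)) Y (fun ω => (X ω, D ω)) μ : ℝ≥0∞) : EReal) := by
  have hT : Measurable fun ω => (X ω, D ω) := hX.prodMk hD
  have hU : Measurable fun ω => Ψ (X ω) (W ω) := hΨ.comp (hX.prodMk hW)
  have hℓ' : Measurable (fun p : 𝓨 × 𝓐 => ℓ p.1 p.2) := hℓ
  rw [minimumExcessRisk, ← hΨ_opt]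
  refine condBayesRisk_sub_integral_le μ hU hY hT hℓ hΨ_int hb ?_
  have hf : Measurable (Function.uncurry fun (t : 𝓧 × 𝓓) (w : 𝓦) => Ψ t.1 w) :=
    hΨ.comp (measurable_fst.fst.prodMk measurable_snd)
  filter_upwards [h, condDistrib_comp_prodMk μ hW hT hf] with t ht hcond
  have hΨt : Measurable (Ψ t.1) := hΨ.of_uncurry_left
  have hg : Measurable fun q : 𝓨 × 𝓦 => (Ψ t.1 q.2, q.1) := by fun_prop
  have hlaw : (condDistrib (fun ω => Ψ (X ω) (W ω)) (fun ω => (X ω, D ω)) μ t).prod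
      (condDistrib Y (fun ω => (X ω, D ω)) μ t)
      = (posteriorSampleLaw Y W (fun ω => (X ω, D ω)) μ t).map
        (fun q : 𝓨 × 𝓦 => (Ψ t.1 q.2, q.1)) := by
    have h1 : (fun q : 𝓨 × 𝓦 => (Ψ t.1 q.2, q.1)) = Prod.map (Ψ t.1) id ∘ Prod.swap := rfl
    rw [hcond, posteriorSampleLaw, h1, ← Measure.map_map (by fun_prop) measurable_swap,
      Measure.prod_swap, ← Measure.map_prod_map _ _ hΨt measurable_id, Measure.map_id]
  rw [hlaw]
  exact HasCGFBound.of_comp (L := fun p : 𝓐 × 𝓨 => ℓ p.2 p.1) (hℓ'.comp measurable_swap) hg ht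

end Posterior

end BayesLearning

/-! ### The three claims assembled. -/

theorem mainTheorem1
    {Ω 𝓧 𝓨 𝓦 𝓐 : Type*} [MeasurableSpace Ω]
    [MeasurableSpace 𝓧] [StandardBorelSpace 𝓧] [Nonempty 𝓧]
    [MeasurableSpace 𝓨] [StandardBorelSpace 𝓨] [Nonempty 𝓨]
    [MeasurableSpace 𝓦] [StandardBorelSpace 𝓦] [Nonempty 𝓦]
    [MeasurableSpace 𝓐] [StandardBorelSpace 𝓐] [Nonempty 𝓐]
    (n : ℕ)
    -- the prior and the parametrized family of distributions of `(X, Y)`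
    (π : Measure 𝓦) [IsProbabilityMeasure π] (P : Kernel 𝓦 (𝓧 × 𝓨)) [IsMarkovKernel P]
    -- the parameters `W`, the data set `Zⁿ` and the fresh pair `(X, Y)`
    (μ : Measure Ω) [IsProbabilityMeasure μ]
    (W : Ω → 𝓦) (Z : Ω → Fin n → 𝓧 × 𝓨) (X : Ω → 𝓧) (Y : Ω → 𝓨)
    (hW : Measurable W) (hZ : Measurable Z) (hX : Measurable X) (hY : Measurable Y)
    (hlaw : μ.map (fun ω => (W ω, Z ω, (X ω, Y ω))) = BayesLearning.jointLaw π P n)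
    -- the loss and the optimal omniscient decision rule
    (ℓ : 𝓨 → 𝓐 → ℝ) (hℓ : Measurable (Function.uncurry ℓ))
    (Ψ : 𝓧 → 𝓦 → 𝓐) (hΨ : Measurable (Function.uncurry Ψ))
    (hΨ_int : Integrable (fun ω => ℓ (Y ω) (Ψ (X ω) (W ω))) μ)
    (hΨ_opt : ((∫ ω, ℓ (Y ω) (Ψ (X ω) (W ω)) ∂μ : ℝ) : EReal)
      = BayesLearning.condBayesRisk ℓ Y (fun ω => (X ω, W ω)) μ) :
    -- the bound on the minimum excess risk
    (∀ (b : EReal) (φ : ℝ → ℝ), 0 < b →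
      (∀ᵐ t ∂(μ.map (fun ω => (X ω, Z ω))),
        BayesLearning.HasCGFBound (fun q : 𝓨 × 𝓦 => ℓ q.1 (Ψ t.1 q.2))
          (BayesLearning.posteriorSampleLaw Y W (fun ω => (X ω, Z ω)) μ t) φ b) →
      BayesLearning.minimumExcessRisk ℓ W Z X Y μ
        ≤ BayesLearning.legendreDualInv φ b
            ((BayesLearning.condMutualInfo (fun ω => Ψ (X ω) (W ω)) Y
              (fun ω => (X ω, Z ω)) μ : ℝ≥0∞) : EReal))
    -- the behaviour of the bound at zero
    ∧ (∀ (b : EReal) (φ : ℝ → ℝ), 0 < b →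
      StrictConvexOn ℝ {l : ℝ | 0 < l ∧ (l : EReal) < b} φ →
      φ 0 = 0 → HasDerivWithinAt φ 0 (Set.Ici 0) 0 →
      Tendsto (fun x : ℝ => BayesLearning.legendreDualInv φ b (x : EReal)) (𝓝[>] 0) (𝓝 0))
    -- the subgaussian case
    ∧ (∀ σ : ℝ, 0 < σ →
      (∀ᵐ t ∂(μ.map (fun ω => (X ω, Z ω))),
        BayesLearning.IsSubgaussian (fun q : 𝓨 × 𝓦 => ℓ q.1 (Ψ t.1 q.2))
          (BayesLearning.posteriorSampleLaw Y W (fun ω => (X ω, Z ω)) μ t) σ) →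
      BayesLearning.minimumExcessRisk ℓ W Z X Y μ
        ≤ (((2 * ENNReal.ofReal (σ ^ 2) *
            BayesLearning.condMutualInfo (fun ω => Ψ (X ω) (W ω)) Y
              (fun ω => (X ω, Z ω)) μ) ^ (1 / 2 : ℝ) : ℝ≥0∞) : EReal)) := by
  refine ⟨fun b φ hb h => ?_, fun b φ hb hφ h0 hd => ?_, fun σ hσ h => ?_⟩
  · exact BayesLearning.minimumExcessRisk_le_legendreDualInv μ hW hZ hX hY hℓ hΨ hΨ_int hΨ_opt hb h
  · exact BayesLearning.tendsto_legendreDualInv hb hφ.convexOn h0 hd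
  · refine (BayesLearning.minimumExcessRisk_le_legendreDualInv μ hW hZ hX hY hℓ hΨ hΨ_int hΨ_opt
      EReal.zero_lt_top ?_).trans (BayesLearning.legendreDualInv_sq_le hσ _)
    filter_upwards [h] with t ht
    have : IsProbabilityMeasure
        (BayesLearning.posteriorSampleLaw Y W (fun ω => (X ω, Z ω)) μ t) := by
      unfold BayesLearning.posteriorSampleLaw
      infer_instance
    exact ht.hasCGFBound
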